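/- Let $E$ be a real locally convex Hausdorff topological vector space, let $K\subseteq E$ be a compact convex set, and suppose that its set of extreme points $\partial_e K$ is closed. Let $A(K)$ be the space of continuous affine functions $K\to\mathbb R$ and $C(\partial_e K)$ the space of continuous functions $\partial_e K\to\mathbb R$, both with the supremum norm and the pointwise order, and let $R:A(K)\to C(\partial_e K)$, $R(a)=a|_{\partial_e K}$, be the restriction map. A functional on either space is positive if it is non-negative on non-negative functions. For regular Borel probability measures $\mu,\nu$ on $K$ write $\mu\prec\nu$ if $\int f\,d\mu\le\int f\,d\nu$ for every continuous convex $f:K\to\mathbb R$; $\mu$ is maximal if $\mu\prec\nu$ implies $\nu=\mu$, and $x\in K$ is the resultant of $\mu$ if $\int a\,d\mu=a(x)$ for all $a\in A(K)$. A compact convex set is a Choquet simplex if each of its points is the resultant of exactly one maximal regular Borel probability measure on it, and a Bauer simplex is a Choquet simplex whose set of extreme points is closed. Then the following are equivalent: (a) for every positive $\varphi\in A(K)^*$ with $\|\varphi\|=1$ there is exactly one positive $\psi\in C(\partial_e K)^*$ with $\psi\circ R=\varphi$; (b) $R$ is an isometry of $A(K)$ onto $C(\partial_e K)$; (c) $K$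 is a Bauer simplex. -/

import Mathlib

open MeasureTheory

section ChoquetTheory

variable {E : Type*} [AddCommGroup E] [Module ℝ E] [TopologicalSpace E]

/-- A real function on the set `K` is affine if it respects all convex combinations of two points
of `K` (that lie in `K`, which is automatic for convex `K`). -/
def IsAffineOnSet (K : Set E) (f : K → ℝ) : Prop :=
  ∀ (x y z : K) (s t : ℝ), 0 ≤ s → 0 ≤ t → s + t = 1 →
    (z : E) = s • (x : E) + t • (y : E) → f z = s * f x + t * f y

/-- A real function on the set `K` is convex. -/
def IsConvexOnSet (K : Set E) (f : K → ℝ) : Prop :=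
  ∀ (x y z : K) (s t : ℝ), 0 ≤ s → 0 ≤ t → s + t = 1 →
    (z : E) = s • (x : E) + t • (y : E) → f z ≤ s * f x + t * f y

/-- The continuous affine real functions on `K`, as a linear subspace of `C(K, ℝ)`. -/
def affineSubspace (K : Set E) : Submodule ℝ C(K, ℝ) where
  carrier := {f | IsAffineOnSet K f}
  add_mem' := by
    intro f g hf hg x y z s t hs ht hst hz
    have h1 := hf x y z s t hs ht hst hz
    have h2 := hg x y z s t hs ht hst hz
    simp only [ContinuousMap.add_apply, h1, h2]
    ring
  zero_mem' := by
    intro x y z s t _ _ _ _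
    simp
  smul_mem' := by
    intro c f hf x y z s t hs ht hst hz
    have h1 := hf x y z s t hs ht hst hz
    simp only [ContinuousMap.smul_apply, smul_eq_mul, h1]
    ring

/-- `A(K)`: the space of continuous affine real functions on `K`. For compact `K` it carries the
supremum norm inherited from `C(K, ℝ)`, and its topology is the one of this norm. -/
def AffineFunctions (K : Set E) : Type _ := affineSubspace K

noncomputable instance (K : Set E) [CompactSpace K] : NormedAddCommGroup (AffineFunctions K) :=
  inferInstanceAs (NormedAddCommGroup (affineSubspace K))

noncomputable instance (K : Set E) [CompactSpace K] : NormedSpace ℝ (AffineFunctions K) :=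
  inferInstanceAs (NormedSpace ℝ (affineSubspace K))

/-- An element of `A(K)` as a continuous function on `K`. -/
def AffineFunctions.toContinuousMap {K : Set E} (a : AffineFunctions K) : C(K, ℝ) :=
  Subtype.val (p := fun f => f ∈ affineSubspace K) a

/-- The restriction map `a ↦ a|∂ₑK` from `A(K)` to `C(∂ₑK, ℝ)`. -/
noncomputable def restrictExtreme (K : Set E) [CompactSpace K] :
    AffineFunctions K →ₗ[ℝ] C(K.extremePoints ℝ, ℝ) where
  toFun a := a.toContinuousMap.comp
    ⟨Set.inclusion extremePoints_subset, continuous_inclusion extremePoints_subset⟩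
  map_add' _ _ := rfl
  map_smul' _ _ := rfl

variable [MeasurableSpace E]

/-- The regular Borel probability measures on `K`. -/
def IsRadonProbability {K : Set E} (μ : Measure K) : Prop :=
  IsProbabilityMeasure μ ∧ μ.Regular

/-- The Choquet ordering: `∫ f dμ ≤ ∫ f dν` for all continuous convex `f` on `K`. -/
def ChoquetLE {K : Set E} (μ ν : Measure K) : Prop :=
  ∀ f : C(K, ℝ), IsConvexOnSet K f → ∫ x, f x ∂μ ≤ ∫ x, f x ∂ν

/-- Probability measures on `K` that are maximal in the Choquet ordering. -/
def IsMaximalProbability {K : Set E} (μ : Measure K) : Prop :=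
  IsRadonProbability μ ∧
    ∀ ν : Measure K, IsRadonProbability ν → ChoquetLE μ ν → ν = μ

/-- `x` is the resultant (barycentre) of `μ`. -/
def HasResultant {K : Set E} (μ : Measure K) (x : K) : Prop :=
  ∀ a : AffineFunctions K, ∫ y, a.toContinuousMap y ∂μ = a.toContinuousMap x

/-- A Choquet simplex: a compact convex set each point of which is the resultant of exactly one
maximal probability measure. -/
def IsChoquetSimplex (K : Set E) : Prop :=
  IsCompact K ∧ Convex ℝ K ∧
    ∀ x : K, ∃! μ : Measure K, IsMaximalProbability μ ∧ HasResultant μ x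

/-- A Bauer simplex: a Choquet simplex whose set of extreme points is closed. -/
def IsBauerSimplex (K : Set E) : Prop :=
  IsChoquetSimplex K ∧ IsClosed (K.extremePoints ℝ)

end ChoquetTheory

/-!
The proof runs around the cycle (a) ⇒ (b) ⇒ (c) ⇒ (a), and everything rests on one Hahn-Banach
argument, `exists_positive_extension`: if a state on a space mapped into `C(X, ℝ)` is at least `c`
on all elements lying above `f`, then it extends to a state of `C(X, ℝ)` whose value at `f` is at
least `c`. By Bauer's maximum principle, a consequence of the Krein-Milman theorem, restriction to
`∂ₑK` is always an isometry that preserves and reflects positivity, so only its surjectivity is at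
stake in (b).

(a) ⇒ (b): let `ψ x` be the unique positive extension of the evaluation at `x`. Uniqueness makes
`x ↦ ψ x` affine, and the extension theorem shows that `ψ x f` is the infimum of `a x` over the
affine `a` above `f` on `∂ₑK`; so `x ↦ ψ x f` is upper semicontinuous, and, on replacing `f` by
`-f`, continuous. It is the required affine extension of `f`.

(b) ⇒ (c): the Riesz-Markov-Kakutani theorem represents `f ↦ (R⁻¹ (f|∂ₑK)) x` by a measure `μ` with
resultant `x`. If `f` is convex, then `f ≤ R⁻¹ (f|∂ₑK)` on `K` by the maximum principle, so every
measure with resultant `x` lies below `μ`. Hence `μ` is the only candidate for a maximal one.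

(c) ⇒ (a): a state of `A(K)` is the evaluation at some `x`
(`AffineFunctions.exists_eq_eval`), and its positive extensions to `C(∂ₑK)` give measures on `K`
with resultant `x`. As measures carried by `∂ₑK` they are maximal, hence equal.

The maximality of measures carried by `∂ₑK`, used in both of the last two steps, is
`isMaximalProbability_of_nonneg_on_extremePoints`. An extreme point is represented only by its
Dirac measure (`apply_eq_of_mem_extremePoints`), so by the extension theorem every continuous `f`
has affine majorants that are almost equal to it at a given extreme point; compactness of `∂ₑK`
turns them into one concave majorant `k` with `k < f + ε` on all of `∂ₑK`. If `μ` is carried by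
`∂ₑK` and `μ ≺ ν`, then `∫ f dν ≤ ∫ k dν ≤ ∫ k dμ ≤ ∫ f dμ + ε`. Thus `μ` and `ν` agree on the
continuous convex functions, whose differences are dense in `C(K, ℝ)`.
-/

/-! ### Positive functionals on spaces of continuous functions -/

section PositiveFunctionals

variable {X : Type*} [TopologicalSpace X] [CompactSpace X]

theorem abs_apply_le_of_positive (ψ : C(X, ℝ) →ₗ[ℝ] ℝ) (hψ : ∀ g : C(X, ℝ), 0 ≤ g → 0 ≤ ψ g)
    (g : C(X, ℝ)) : |ψ g| ≤ ψ 1 * ‖g‖ := by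
  have h1 : 0 ≤ ψ (‖g‖ • 1 - g) := hψ _ fun x => by
    have := (abs_le.1 (g.norm_coe_le_norm x)).2
    simpa using this
  have h2 : 0 ≤ ψ (‖g‖ • 1 + g) := hψ _ <| ContinuousMap.le_def.2 fun x => by
    have := (abs_le.1 (g.norm_coe_le_norm x)).1
    simp only [ContinuousMap.zero_apply, ContinuousMap.add_apply, ContinuousMap.smul_apply,
      ContinuousMap.one_apply, smul_eq_mul, mul_one]
    linarith
  simp only [map_sub, map_add, map_smul, smul_eq_mul] at h1 h2
  rw [abs_le]
  constructor <;> linarith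

theorem continuous_of_positive (ψ : C(X, ℝ) →ₗ[ℝ] ℝ)
    (hψ : ∀ g : C(X, ℝ), 0 ≤ g → 0 ≤ ψ g) : Continuous ψ :=
  AddMonoidHomClass.continuous_of_bound ψ (ψ 1) fun g => abs_apply_le_of_positive ψ hψ g

theorem isOpen_setOf_forall_lt (k : C(X, ℝ)) : IsOpen {g : C(X, ℝ) | ∀ x, g x < k x} := by
  have h : IsOpen {g : C(X, ℝ) | Set.MapsTo g Set.univ (Set.Ioi 0)} :=
    ContinuousMap.isOpen_setOfPred_mapsTo isCompact_univ isOpen_Ioi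
  have hc : Continuous fun g : C(X, ℝ) => k - g := continuous_const.sub continuous_id
  convert h.preimage hc using 1
  ext g
  simp [Set.MapsTo]

/-- A Hahn-Banach theorem for states. A normalised functional `φ` that is positive relative to a
unital linear map `T` into `C(X, ℝ)` factors through `T` as a positive functional, and the value of
the latter at `f` can be made at least `c`, provided that `φ` does not rule this out on the
elements of the range of `T` above `f`. -/
theorem exists_positive_extension {V : Type*} [AddCommGroup V] [Module ℝ V]
    (T : V →ₗ[ℝ] C(X, ℝ)) (u : V) (hu : T u = 1) (φ : V →ₗ[ℝ] ℝ) (hφu : φ u = 1)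
    (f : C(X, ℝ)) (c : ℝ) (h : ∀ a, (∀ x, f x < T a x) → c < φ a) :
    ∃ ψ : StrongDual ℝ C(X, ℝ), (∀ g : C(X, ℝ), 0 ≤ g → 0 ≤ ψ g) ∧ (∀ a, ψ (T a) = φ a) ∧
      c ≤ ψ f := by
  -- The open convex cone of all functions dominated strictly by an element of `T (ker φ)`.
  let W : Set C(X, ℝ) := {g | ∃ a, φ a = 0 ∧ ∀ x, g x < T a x}
  have hWo : IsOpen W := by
    have : W = ⋃ a ∈ {a | φ a = 0}, {g : C(X, ℝ) | ∀ x, g x < T a x} := by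
      ext g; simp [W]
    rw [this]
    exact isOpen_biUnion fun a _ => isOpen_setOf_forall_lt _
  have hWs : ∀ r : ℝ, 0 < r → ∀ g ∈ W, r • g ∈ W := by
    rintro r hr g ⟨a, ha, hg⟩
    refine ⟨r • a, by simp [ha], fun x => ?_⟩
    simpa using mul_lt_mul_of_pos_left (hg x) hr
  have hWa : ∀ g ∈ W, ∀ k ∈ W, g + k ∈ W := by
    rintro g ⟨a, ha, hg⟩ k ⟨b, hb, hk⟩
    refine ⟨a + b, by simp [ha, hb], fun x => ?_⟩
    simpa using add_lt_add (hg x) (hk x)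
  have hWc : Convex ℝ W := convex_iff_forall_pos.2 fun g hg k hk s t hs ht _ =>
    hWa _ (hWs s hs g hg) _ (hWs t ht k hk)
  have hf : f - c • 1 ∉ W := by
    rintro ⟨a, ha, hfa⟩
    have := h (a + c • u) fun x => by
      have := hfa x
      simp only [ContinuousMap.sub_apply, ContinuousMap.smul_apply, ContinuousMap.one_apply,
        smul_eq_mul, mul_one] at this
      simp only [map_add, map_smul, hu, ContinuousMap.add_apply, ContinuousMap.smul_apply,
        ContinuousMap.one_apply, smul_eq_mul, mul_one]
      linarith
    simp [ha, hφu] at this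
  obtain ⟨Λ, hΛ⟩ := geometric_hahn_banach_open_point hWc hWo hf
  set M := Λ (f - c • 1) with hM
  have hneg : ∀ g ∈ W, Λ g ≤ 0 := by
    intro g hg
    by_contra! hpos
    have := hΛ _ (hWs ((|M| + 1) / Λ g) (by positivity) g hg)
    rw [map_smul, smul_eq_mul, div_mul_cancel₀ _ hpos.ne'] at this
    linarith [le_abs_self M]
  have hone : ∀ δ : ℝ, 0 < δ → -(δ • (1 : C(X, ℝ))) ∈ W := fun δ hδ =>
    ⟨0, by simp, fun x => by simpa using hδ⟩
  have hshift : ∀ g : C(X, ℝ), (∀ δ : ℝ, 0 < δ → g - δ • 1 ∈ W) → Λ g ≤ 0 := by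
    intro g hg
    refine le_of_forall_pos_le_add fun ε hε => ?_
    have hΛ1 : 0 ≤ Λ 1 := by simpa using hneg _ (hone 1 one_pos)
    have := hneg _ (hg (ε / (Λ 1 + 1)) (by positivity))
    rw [map_sub, map_smul, smul_eq_mul] at this
    have h2 : ε / (Λ 1 + 1) * Λ 1 ≤ ε := by
      rw [div_mul_eq_mul_div, div_le_iff₀ (by positivity)]
      nlinarith
    linarith
  have hpos : ∀ g : C(X, ℝ), 0 ≤ g → 0 ≤ Λ g := by
    intro g hg
    have := hshift (-g) fun δ hδ => ⟨0, by simp, fun x => by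
      have := ContinuousMap.le_def.1 hg x
      simp only [ContinuousMap.zero_apply] at this
      simp only [ContinuousMap.sub_apply, ContinuousMap.neg_apply, ContinuousMap.smul_apply,
        ContinuousMap.one_apply, smul_eq_mul, mul_one, map_zero, ContinuousMap.zero_apply]
      linarith⟩
    simpa using this
  have hle : ∀ a, φ a = 0 → Λ (T a) ≤ 0 := fun a ha =>
    hshift _ fun δ hδ => ⟨a, ha, fun x => by simpa using hδ⟩
  have hker : ∀ a, φ a = 0 → Λ (T a) = 0 := fun a ha =>
    le_antisymm (hle a ha) (by simpa using hle (-a) (by simp [ha]))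
  have hM0 : 0 ≤ M := by
    by_contra! hlt
    have h0 : 0 ≤ Λ 1 := hpos 1 fun x => zero_le_one
    have h1 := hΛ _ (hone (-M / (Λ 1 + 1)) (div_pos (by linarith) (by positivity)))
    rw [map_neg, map_smul, smul_eq_mul, div_mul_eq_mul_div, neg_lt, lt_div_iff₀ (by positivity)]
      at h1
    nlinarith
  have hΛ1 : 0 < Λ 1 := by
    refine lt_of_le_of_ne (hpos 1 fun x => zero_le_one) fun h0 => ?_
    have hz : ∀ g, Λ g = 0 := fun g => by
      have := abs_apply_le_of_positive Λ.toLinearMap hpos g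
      simp only [ContinuousLinearMap.coe_coe, ← h0, zero_mul] at this
      exact abs_nonpos_iff.1 this
    have := hΛ _ (hone 1 one_pos)
    rw [hM, hz, hz] at this
    exact lt_irrefl _ this
  refine ⟨(Λ 1)⁻¹ • Λ, fun g hg => mul_nonneg (by positivity) (hpos g hg), fun a => ?_, ?_⟩
  · have := hker (a - φ a • u) (by simp [hφu])
    rw [map_sub, map_smul, hu, map_sub, map_smul, sub_eq_zero] at this
    simp [this, mul_comm, hΛ1.ne']
  · have : c * Λ 1 ≤ Λ f := by
      rw [hM, map_sub, map_smul, smul_eq_mul] at hM0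
      linarith
    simpa [inv_mul_eq_div] using (le_div_iff₀ hΛ1).2 this

end PositiveFunctionals

/-! ### Continuous affine functions on a compact convex set -/

section Affine

variable {E : Type*} [AddCommGroup E] [Module ℝ E]

theorem IsAffineOnSet.isConvexOnSet {K : Set E} {f : K → ℝ} (hf : IsAffineOnSet K f) :
    IsConvexOnSet K f := fun x y z s t hs ht hst hz => (hf x y z s t hs ht hst hz).le

theorem IsConvexOnSet.add {K : Set E} {f g : K → ℝ} (hf : IsConvexOnSet K f)
    (hg : IsConvexOnSet K g) : IsConvexOnSet K (f + g) := fun x y z s t hs ht hst hz => by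
  have h1 := hf x y z s t hs ht hst hz
  have h2 := hg x y z s t hs ht hst hz
  simp only [Pi.add_apply]
  linarith

theorem IsConvexOnSet.sup {K : Set E} {f g : K → ℝ} (hf : IsConvexOnSet K f)
    (hg : IsConvexOnSet K g) : IsConvexOnSet K (f ⊔ g) := fun x y z s t hs ht hst hz =>
  sup_le
    ((hf x y z s t hs ht hst hz).trans <| by gcongr <;> exact le_sup_left)
    ((hg x y z s t hs ht hst hz).trans <| by gcongr <;> exact le_sup_right)

variable [TopologicalSpace E]

namespace AffineFunctions

variable {K : Set E}

theorem isAffineOnSet (a : AffineFunctions K) : IsAffineOnSet K a.toContinuousMap := a.2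

/-- The constant function `1` as an element of `A(K)`. -/
def one (K : Set E) : AffineFunctions K :=
  ⟨1, fun _ _ _ s t _ _ hst _ => by simp [hst]⟩

@[simp] theorem toContinuousMap_one : (one K).toContinuousMap = 1 := rfl

/-- The restriction to `K` of a continuous linear functional. -/
def ofDual (K : Set E) (l : StrongDual ℝ E) : AffineFunctions K :=
  ⟨⟨fun x => l x, l.continuous.comp continuous_subtype_val⟩, fun x y z s t _ _ _ hz => by
    simp [hz]⟩

variable [CompactSpace K]

/-- The inclusion of `A(K)` into `C(K, ℝ)`. -/
noncomputable def inclusion (K : Set E) [CompactSpace K] : AffineFunctions K →ₗ[ℝ] C(K, ℝ) where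
  toFun a := a.toContinuousMap
  map_add' _ _ := rfl
  map_smul' _ _ := rfl

@[simp] theorem inclusion_apply (a : AffineFunctions K) : inclusion K a = a.toContinuousMap := rfl

@[simp] theorem add_apply (a b : AffineFunctions K) (x : K) :
    (a + b).toContinuousMap x = a.toContinuousMap x + b.toContinuousMap x := rfl

@[simp] theorem sub_apply (a b : AffineFunctions K) (x : K) :
    (a - b).toContinuousMap x = a.toContinuousMap x - b.toContinuousMap x := rfl

@[simp] theorem neg_apply (a : AffineFunctions K) (x : K) :
    (-a).toContinuousMap x = -a.toContinuousMap x := rfl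

@[simp] theorem smul_apply (r : ℝ) (a : AffineFunctions K) (x : K) :
    (r • a).toContinuousMap x = r * a.toContinuousMap x := rfl

/-- Evaluation at a point as a linear functional on `A(K)`. -/
noncomputable def eval (x : K) : AffineFunctions K →ₗ[ℝ] ℝ where
  toFun a := a.toContinuousMap x
  map_add' _ _ := rfl
  map_smul' _ _ := rfl

@[simp] theorem eval_apply (x : K) (a : AffineFunctions K) : eval x a = a.toContinuousMap x := rfl

end AffineFunctions

open AffineFunctions

variable {K : Set E}

/-- Every state of `A(K)` is the evaluation at a point of `K`. -/
theorem AffineFunctions.exists_eq_eval [CompactSpace K] (hconv : Convex ℝ K)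
    (φ : AffineFunctions K →ₗ[ℝ] ℝ) (h1 : φ (one K) = 1)
    (hφ : ∀ a : AffineFunctions K, (∀ x : K, 0 ≤ a.toContinuousMap x) → 0 ≤ φ a) :
    ∃ x : K, ∀ a : AffineFunctions K, φ a = a.toContinuousMap x := by
  have key : (⋂ a : AffineFunctions K, {x : K | φ a = a.toContinuousMap x}).Nonempty := by
    refine CompactSpace.iInter_nonempty
      (fun a => isClosed_eq continuous_const a.toContinuousMap.continuous) fun F => ?_
    -- For finitely many functions, separate in a finite-dimensional space.
    let G : K → (F → ℝ) := fun x a => a.1.toContinuousMap x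
    have hG : Continuous G := continuous_pi fun a => a.1.toContinuousMap.continuous
    have hcl : IsClosed (Set.range G) := (isCompact_range hG).isClosed
    classical
    have hcv : Convex ℝ (Set.range G) := by
      rintro _ ⟨y, rfl⟩ _ ⟨z, rfl⟩ s t hs ht hst
      refine ⟨⟨s • (y : E) + t • (z : E), hconv y.2 z.2 hs ht hst⟩, ?_⟩
      ext a
      exact a.1.isAffineOnSet y z _ s t hs ht hst rfl
    by_cases hmem : (fun a : F => φ a.1) ∈ Set.range G
    · obtain ⟨x, hx⟩ := hmem
      refine ⟨x, ?_⟩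
      simp only [Set.mem_iInter]
      intro a ha
      exact (congrFun hx ⟨a, ha⟩).symm
    · exfalso
      obtain ⟨l, c, hl, hlc⟩ := geometric_hahn_banach_point_closed hcv hcl hmem
      let b : AffineFunctions K := ∑ a : F, l (Pi.single a 1) • a.1
      have hlsum : ∀ v : F → ℝ, l v = ∑ a : F, l (Pi.single a 1) * v a := fun v => by
        have := l.toLinearMap.pi_apply_eq_sum_univ v
        simp only [ContinuousLinearMap.coe_coe, smul_eq_mul] at this
        rw [this]
        refine Finset.sum_congr rfl fun a _ => ?_
        rw [mul_comm]
        congr 2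
        ext j
        simp [Pi.single_apply, eq_comm]
      have hb : ∀ x, b.toContinuousMap x = l (G x) := fun x => by
        rw [hlsum, ← eval_apply, map_sum]
        rfl
      have hφb : φ b = l fun a : F => φ a.1 := by
        rw [hlsum, map_sum]
        simp
      have := hφ (b - c • one K) fun x => by
        have := hlc _ ⟨x, rfl⟩
        simp [hb, this.le]
      rw [map_sub, map_smul, h1, hφb, smul_eq_mul, mul_one] at this
      linarith
  obtain ⟨x, hx⟩ := key
  exact ⟨x, fun a => Set.mem_iInter.1 hx a⟩

/-! ### Extreme points and upper envelopes -/

variable [IsTopologicalAddGroup E] [ContinuousSMul ℝ E] [LocallyConvexSpace ℝ E] [T2Space E]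

/-- Bauer's maximum principle. -/
theorem IsConvexOnSet.le_of_forall_extremePoints_le (hK : IsCompact K) (hconv : Convex ℝ K)
    {f : C(K, ℝ)} (hf : IsConvexOnSet K f) {c : ℝ}
    (h : ∀ x : K, (x : E) ∈ K.extremePoints ℝ → f x ≤ c) (x : K) : f x ≤ c := by
  have : CompactSpace K := isCompact_iff_compactSpace.mp hK
  let S : Set E := Subtype.val '' {x : K | f x ≤ c}
  have hcl : IsClosed S :=
    ((isClosed_le f.continuous continuous_const).isCompact.image continuous_subtype_val).isClosed
  have hS : Convex ℝ S := by
    rintro _ ⟨y, hy, rfl⟩ _ ⟨z, hz, rfl⟩ s t hs ht hst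
    refine ⟨⟨s • (y : E) + t • (z : E), hconv y.2 z.2 hs ht hst⟩, ?_, rfl⟩
    refine (hf y z _ s t hs ht hst rfl).trans ?_
    calc s * f y + t * f z ≤ s * c + t * c := by gcongr <;> assumption
      _ = c := by rw [← add_mul, hst, one_mul]
  have hsub : K.extremePoints ℝ ⊆ S := fun y hy =>
    ⟨⟨y, extremePoints_subset hy⟩, h ⟨y, extremePoints_subset hy⟩ hy, rfl⟩
  have hx : (x : E) ∈ closure (convexHull ℝ (K.extremePoints ℝ)) := by
    rw [closure_convexHull_extremePoints hK hconv]
    exact x.2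
  obtain ⟨y, hy, hyx⟩ := closure_minimal (convexHull_min hsub hS) hcl hx
  rwa [← Subtype.ext hyx]

theorem AffineFunctions.nonneg_of_forall_extremePoints [CompactSpace K] (hK : IsCompact K)
    (hconv : Convex ℝ K) {a : AffineFunctions K}
    (h : ∀ x : K, (x : E) ∈ K.extremePoints ℝ → 0 ≤ a.toContinuousMap x) (x : K) :
    0 ≤ a.toContinuousMap x := by
  have := (-a).isAffineOnSet.isConvexOnSet.le_of_forall_extremePoints_le hK hconv (c := 0)
    (fun y hy => by simpa using h y hy) x
  simpa using this

theorem AffineFunctions.exists_apply_ne {x y : K} (hxy : x ≠ y) :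
    ∃ a : AffineFunctions K, a.toContinuousMap x ≠ a.toContinuousMap y := by
  obtain ⟨l, hl⟩ := geometric_hahn_banach_point_point fun h => hxy (Subtype.ext h)
  exact ⟨ofDual K l, hl.ne⟩

/-- An extreme point of `K` is represented only by its Dirac measure. -/
theorem apply_eq_of_mem_extremePoints [CompactSpace K] (hconv : Convex ℝ K) {x : K}
    (hx : (x : E) ∈ K.extremePoints ℝ) (ψ : StrongDual ℝ C(K, ℝ))
    (hψ : ∀ g : C(K, ℝ), 0 ≤ g → 0 ≤ ψ g)
    (hrep : ∀ a : AffineFunctions K, ψ a.toContinuousMap = a.toContinuousMap x) (g : C(K, ℝ)) :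
    ψ g = g x := by
  have hone : ψ 1 = 1 := hrep (one K)
  -- Normalising `g ψ` and `(1 - g) ψ` decomposes `x` into a proper convex combination.
  have hsmall : ∀ g : C(K, ℝ), 0 ≤ g → 0 ≤ 1 - g → 0 < ψ g → 0 < ψ (1 - g) →
      ∃ y : K, ∀ a : AffineFunctions K, ψ (g * a.toContinuousMap) = ψ g * a.toContinuousMap y := by
    intro g hg0 _ hg _
    obtain ⟨y, hy⟩ := exists_eq_eval hconv
      ((ψ g)⁻¹ • (ψ.toLinearMap ∘ₗ LinearMap.mulLeft ℝ g ∘ₗ inclusion K))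
      (by simp [hg.ne']) (fun a ha => by
        refine mul_nonneg (by positivity) (hψ _ fun z => mul_nonneg (hg0 z) (ha z)))
    refine ⟨y, fun a => ?_⟩
    rw [← hy]
    simp [hg.ne']
  have hmid : ∀ g : C(K, ℝ), 0 ≤ g → 0 ≤ 1 - g → 0 < ψ g → 0 < ψ (1 - g) →
      ∀ a : AffineFunctions K, ψ (g * a.toContinuousMap) = ψ g * a.toContinuousMap x := by
    intro g h0 h1 hg hg'
    obtain ⟨y, hy⟩ := hsmall g h0 h1 hg hg'
    obtain ⟨z, hz⟩ := hsmall (1 - g) h1 (by simpa using h0) hg' (by simpa using hg)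
    have hsum : ψ g + ψ (1 - g) = 1 := by rw [← map_add, add_sub_cancel, hone]
    let w : K := ⟨ψ g • (y : E) + ψ (1 - g) • (z : E), hconv y.2 z.2 hg.le hg'.le hsum⟩
    have hxw : x = w := by
      by_contra hne
      obtain ⟨a, ha⟩ := exists_apply_ne hne
      refine ha ?_
      rw [a.isAffineOnSet y z w _ _ hg.le hg'.le hsum rfl, ← hy, ← hz, ← map_add, ← add_mul,
        add_sub_cancel, one_mul, hrep]
    have hyx : y = x := Subtype.ext <|
      hx.2 y.2 z.2 ⟨ψ g, ψ (1 - g), hg, hg', hsum, (congrArg Subtype.val hxw).symm⟩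
    rwa [hyx] at hy
  have hall : ∀ g : C(K, ℝ), ∀ a : AffineFunctions K,
      ψ (g * a.toContinuousMap) = ψ g * a.toContinuousMap x := by
    intro g a
    -- Rescale `g` to take values in `[1/4, 3/4]`.
    obtain ⟨δ, hδ, hδg⟩ : ∃ δ : ℝ, 0 < δ ∧ ∀ z, |δ * g z| ≤ 1 / 4 := by
      refine ⟨1 / (4 * (‖g‖ + 1)), by positivity, fun z => ?_⟩
      rw [abs_mul, abs_of_pos (by positivity), div_mul_eq_mul_div, one_mul,
        div_le_iff₀ (by positivity)]
      have := g.norm_coe_le_norm z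
      rw [Real.norm_eq_abs] at this
      linarith
    let k : C(K, ℝ) := (1 / 2 : ℝ) • 1 + δ • g
    have hk : ∀ z, 1 / 4 ≤ k z ∧ k z ≤ 3 / 4 := fun z => by
      have := abs_le.1 (hδg z)
      simp only [k, ContinuousMap.add_apply, ContinuousMap.smul_apply, ContinuousMap.one_apply,
        smul_eq_mul]
      constructor <;> linarith
    have hpos1 : 0 ≤ ψ (k - (1 / 4 : ℝ) • 1) := hψ _ fun z => by
      simpa using (hk z).1
    have hpos2 : 0 ≤ ψ ((1 - k) - (1 / 4 : ℝ) • 1) := hψ _ <| ContinuousMap.le_def.2 fun z => by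
      have := (hk z).2
      simp only [ContinuousMap.zero_apply, ContinuousMap.sub_apply, ContinuousMap.smul_apply,
        ContinuousMap.one_apply, smul_eq_mul]
      linarith
    rw [map_sub, map_smul, hone, smul_eq_mul] at hpos1 hpos2
    have := hmid k (fun z => le_trans (by norm_num) (hk z).1)
      (ContinuousMap.le_def.2 fun z => by
        have := (hk z).2
        simp only [ContinuousMap.zero_apply, ContinuousMap.sub_apply, ContinuousMap.one_apply]
        linarith)
      (by linarith) (by linarith) a
    simp only [k, add_mul, smul_mul_assoc, one_mul, map_add, map_smul, hone, hrep, smul_eq_mul,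
      mul_one] at this
    have h2 : δ * ψ (g * a.toContinuousMap) = δ * (ψ g * a.toContinuousMap x) := by linarith
    exact mul_left_cancel₀ hδ.ne' h2
  -- Hence `ψ` is multiplicative on a closed subalgebra that separates points.
  let H : Subalgebra ℝ C(K, ℝ) :=
    { carrier := {h | ∀ g, ψ (g * h) = ψ g * h x}
      mul_mem' := fun {h₁ h₂} H₁ H₂ g => by
        rw [← mul_assoc, H₂, H₁, mul_assoc, ContinuousMap.mul_apply]
      add_mem' := fun {h₁ h₂} H₁ H₂ g => by
        rw [mul_add, map_add, H₁, H₂, ← mul_add, ContinuousMap.add_apply]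
      algebraMap_mem' := fun r g => by
        rw [Algebra.algebraMap_eq_smul_one, mul_smul_comm, mul_one, map_smul]
        simp [mul_comm] }
  have hHcl : IsClosed (H : Set C(K, ℝ)) := by
    have : (H : Set C(K, ℝ)) = ⋂ g, {h | ψ (g * h) = ψ g * h x} := by
      ext h
      simp only [Set.mem_iInter]
      rfl
    rw [this]
    exact isClosed_iInter fun g => isClosed_eq (by fun_prop)
      (continuous_const.mul (continuous_eval_const x))
  have hH : H = ⊤ := by
    rw [← ContinuousMap.subalgebra_topologicalClosure_eq_top_of_separatesPoints H]
    · exact (le_antisymm H.le_topologicalClosure (H.topologicalClosure_minimal le_rfl hHcl))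
    · intro y z hyz
      obtain ⟨a, ha⟩ := exists_apply_ne hyz
      exact ⟨_, ⟨a.toContinuousMap, fun g => hall g a, rfl⟩, ha⟩
  have hg : g ∈ H := hH ▸ trivial
  simpa [hone] using hg 1

/-- The upper envelope of a continuous function agrees with the function at extreme points. -/
theorem exists_affine_majorant [CompactSpace K] (hconv : Convex ℝ K) {x : K}
    (hx : (x : E) ∈ K.extremePoints ℝ) (f : C(K, ℝ)) {ε : ℝ} (hε : 0 < ε) :
    ∃ a : AffineFunctions K, (∀ y, f y < a.toContinuousMap y) ∧ a.toContinuousMap x < f x + ε := by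
  by_contra! h
  obtain ⟨ψ, hψ, hrep, hc⟩ := exists_positive_extension (inclusion K) (one K) rfl (eval x)
    (by simp) f (f x + ε / 2) fun a ha => lt_of_lt_of_le (by linarith) (h a ha)
  rw [apply_eq_of_mem_extremePoints hconv hx ψ hψ hrep] at hc
  linarith

theorem exists_concave_majorant [CompactSpace K] (hconv : Convex ℝ K)
    (hext : IsClosed (K.extremePoints ℝ)) (f : C(K, ℝ)) {ε : ℝ} (hε : 0 < ε) :
    ∃ h : C(K, ℝ), IsConvexOnSet K (-h) ∧ f ≤ h ∧
      ∀ x : K, (x : E) ∈ K.extremePoints ℝ → h x < f x + ε := by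
  have hc : IsCompact {x : K | (x : E) ∈ K.extremePoints ℝ} :=
    (hext.preimage continuous_subtype_val).isCompact
  refine hc.induction_on (p := fun s => ∃ h : C(K, ℝ), IsConvexOnSet K (-h) ∧ f ≤ h ∧
      ∀ x ∈ s, h x < f x + ε) ?_ ?_ ?_ ?_
  · refine ⟨(‖f‖ • one K).toContinuousMap, (-(‖f‖ • one K)).isAffineOnSet.isConvexOnSet,
      fun x => ?_, by simp⟩
    simpa using (le_abs_self _).trans (f.norm_coe_le_norm x)
  · rintro s t hst ⟨h, h1, h2, h3⟩
    exact ⟨h, h1, h2, fun x hx => h3 x (hst hx)⟩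
  · rintro s t ⟨h, h1, h2, h3⟩ ⟨k, k1, k2, k3⟩
    refine ⟨h ⊓ k, ?_, le_inf h2 k2, ?_⟩
    · have := h1.sup k1
      convert this using 1
      ext x
      simp [neg_inf]
    · rintro x (hx | hx)
      · exact lt_of_le_of_lt inf_le_left (h3 x hx)
      · exact lt_of_le_of_lt inf_le_right (k3 x hx)
  · intro x hx
    obtain ⟨a, ha, hax⟩ := exists_affine_majorant hconv hx f hε
    refine ⟨{y | a.toContinuousMap y < f y + ε}, mem_nhdsWithin_of_mem_nhds ?_,
      a.toContinuousMap, (-a).isAffineOnSet.isConvexOnSet, fun y => (ha y).le, fun y hy => hy⟩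
    exact (isOpen_lt (by fun_prop) (by fun_prop)).mem_nhds hax

end Affine

open AffineFunctions

/-! ### Representing measures and maximality -/

section Measures

theorem exists_radonProbability {X : Type*} [TopologicalSpace X] [CompactSpace X] [T2Space X]
    [MeasurableSpace X] [BorelSpace X] (Ψ : C(X, ℝ) →ₗ[ℝ] ℝ) (h1 : Ψ 1 = 1)
    (hΨ : ∀ g : C(X, ℝ), 0 ≤ g → 0 ≤ Ψ g) :
    ∃ μ : Measure X, IsProbabilityMeasure μ ∧ μ.Regular ∧ ∀ g : C(X, ℝ), ∫ x, g x ∂μ = Ψ g := by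
  let Λ : CompactlySupportedContinuousMap X ℝ →ₚ[ℝ] ℝ :=
    { toFun g := Ψ g.toContinuousMap
      map_add' g k := Ψ.map_add _ _
      map_smul' c g := Ψ.map_smul _ _
      monotone' g k hgk := by
        have := hΨ (k.toContinuousMap - g.toContinuousMap) <| ContinuousMap.le_def.2 fun x =>
          sub_nonneg.2 (hgk x)
        rw [map_sub] at this
        exact sub_nonneg.1 this }
  have hint : ∀ g : C(X, ℝ), ∫ x, g x ∂(RealRMK.rieszMeasure Λ) = Ψ g := fun g =>
    RealRMK.integral_rieszMeasure Λ (CompactlySupportedContinuousMap.continuousMapEquiv g)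
  refine ⟨RealRMK.rieszMeasure Λ, ⟨?_⟩, inferInstance, hint⟩
  have := hint 1
  simp only [ContinuousMap.one_apply, integral_const, smul_eq_mul, mul_one, h1,
    Measure.real] at this
  rwa [ENNReal.toReal_eq_one_iff] at this

theorem ContinuousMap.integrable_of_compactSpace {X : Type*} [TopologicalSpace X] [CompactSpace X]
    [MeasurableSpace X] [BorelSpace X] (μ : Measure X) [IsFiniteMeasure μ] (f : C(X, ℝ)) :
    Integrable f μ :=
  f.continuous.integrable_of_hasCompactSupport (HasCompactSupport.of_compactSpace f)

/-- Integration against a finite measure as a linear functional on the continuous functions. -/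
noncomputable def integralFunctional {X : Type*} [TopologicalSpace X] [CompactSpace X]
    [MeasurableSpace X] [BorelSpace X] (μ : Measure X) [IsFiniteMeasure μ] : C(X, ℝ) →ₗ[ℝ] ℝ where
  toFun f := ∫ x, f x ∂μ
  map_add' f g := integral_add (f.integrable_of_compactSpace μ) (g.integrable_of_compactSpace μ)
  map_smul' c f := integral_smul c f

theorem continuous_integralFunctional {X : Type*} [TopologicalSpace X] [CompactSpace X]
    [MeasurableSpace X] [BorelSpace X] (μ : Measure X) [IsFiniteMeasure μ] :
    Continuous (integralFunctional μ) :=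
  continuous_of_positive _ fun _ hg => integral_nonneg hg

variable {E : Type*} [AddCommGroup E] [Module ℝ E] [TopologicalSpace E]
  [IsTopologicalAddGroup E] [ContinuousSMul ℝ E] [LocallyConvexSpace ℝ E] [T2Space E]
  {K : Set E} [CompactSpace K]

/-- The differences of continuous convex functions form a vector lattice that separates points. -/
theorem closure_sub_convex_eq_univ :
    closure {h : C(K, ℝ) | ∃ f g : C(K, ℝ), IsConvexOnSet K f ∧ IsConvexOnSet K g ∧ h = f - g} =
      Set.univ := by
  set L := {h : C(K, ℝ) | ∃ f g : C(K, ℝ), IsConvexOnSet K f ∧ IsConvexOnSet K g ∧ h = f - g}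
  have haff : ∀ a : AffineFunctions K, a.toContinuousMap ∈ L := fun a =>
    ⟨a.toContinuousMap, 0, a.isAffineOnSet.isConvexOnSet,
      (0 : AffineFunctions K).isAffineOnSet.isConvexOnSet, (sub_zero _).symm⟩
  have hneg : ∀ h ∈ L, -h ∈ L := by
    rintro _ ⟨f, g, hf, hg, rfl⟩
    exact ⟨g, f, hg, hf, neg_sub f g⟩
  have hsup : ∀ h ∈ L, ∀ k ∈ L, h ⊔ k ∈ L := by
    rintro _ ⟨f₁, g₁, hf₁, hg₁, rfl⟩ _ ⟨f₂, g₂, hf₂, hg₂, rfl⟩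
    refine ⟨(f₁ + g₂) ⊔ (f₂ + g₁), g₁ + g₂, (hf₁.add hg₂).sup (hf₂.add hg₁), hg₁.add hg₂, ?_⟩
    ext x
    simp only [ContinuousMap.sup_apply, ContinuousMap.sub_apply, ContinuousMap.add_apply]
    rw [← max_sub_sub_right]
    congr 1 <;> ring
  refine ContinuousMap.sublattice_closure_eq_top L ⟨_, haff 0⟩ (fun h hh k hk => ?_) hsup ?_
  · have := hneg _ (hsup _ (hneg _ hh) _ (hneg _ hk))
    rwa [← neg_inf, neg_neg] at this
  · intro v x y
    by_cases hxy : x = y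
    · subst hxy
      exact ⟨_, haff (v x • one K), by simp, by simp⟩
    · obtain ⟨a, ha⟩ := exists_apply_ne hxy
      have hd : a.toContinuousMap x - a.toContinuousMap y ≠ 0 := sub_ne_zero.2 ha
      refine ⟨_, haff (((v x - v y) / (a.toContinuousMap x - a.toContinuousMap y)) •
        (a - a.toContinuousMap y • one K) + v y • one K), ?_, ?_⟩
      · simp [hd]
      · simp

variable [MeasurableSpace E] [BorelSpace E]

theorem IsRadonProbability.ext_of_convex {μ ν : Measure K} (hμ : IsRadonProbability μ)
    (hν : IsRadonProbability ν)
    (h : ∀ f : C(K, ℝ), IsConvexOnSet K f → ∫ x, f x ∂μ = ∫ x, f x ∂ν) : μ = ν := by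
  have := hμ.1
  have := hμ.2
  have := hν.1
  have := hν.2
  have hcl : IsClosed {f | integralFunctional μ f = integralFunctional ν f} :=
    isClosed_eq (continuous_integralFunctional μ) (continuous_integralFunctional ν)
  have hall : ∀ f, integralFunctional μ f = integralFunctional ν f := fun f => by
    refine closure_minimal ?_ hcl (closure_sub_convex_eq_univ (K := K) ▸ Set.mem_univ f)
    rintro _ ⟨f, g, hf, hg, rfl⟩
    simp only [Set.mem_ofPred_eq, map_sub]
    exact congrArg₂ _ (h f hf) (h g hg)
  exact Measure.ext_of_integral_eq_on_compactlySupported fun f => hall f.toContinuousMap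

/-- Probability measures carried by the closed set `∂ₑK` are maximal. Being carried by `∂ₑK` is
expressed through positivity on the functions that are non-negative on `∂ₑK`. -/
theorem isMaximalProbability_of_nonneg_on_extremePoints (hconv : Convex ℝ K)
    (hext : IsClosed (K.extremePoints ℝ)) {μ : Measure K} (hμ : IsRadonProbability μ)
    (h : ∀ f : C(K, ℝ), (∀ x : K, (x : E) ∈ K.extremePoints ℝ → 0 ≤ f x) → 0 ≤ ∫ x, f x ∂μ) :
    IsMaximalProbability μ := by
  refine ⟨hμ, fun ν hν hle => hν.ext_of_convex hμ fun f hf => le_antisymm ?_ (hle f hf)⟩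
  have := hμ.1
  have := hν.1
  refine le_of_forall_pos_le_add fun ε hε => ?_
  obtain ⟨k, hk, hfk, hkf⟩ := exists_concave_majorant hconv hext f hε
  have h1 : integralFunctional ν f ≤ integralFunctional ν k :=
    integral_mono (f.integrable_of_compactSpace ν) (k.integrable_of_compactSpace ν) hfk
  have h2 : integralFunctional μ (-k) ≤ integralFunctional ν (-k) := hle (-k) hk
  have h3 : 0 ≤ integralFunctional μ (f + ε • 1 - k) := h _ fun x hx => by
    have := hkf x hx
    simp only [ContinuousMap.sub_apply, ContinuousMap.add_apply, ContinuousMap.smul_apply,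
      ContinuousMap.one_apply, smul_eq_mul, mul_one]
    linarith
  have h4 : integralFunctional μ 1 = 1 := by simp [integralFunctional]
  rw [map_neg, map_neg] at h2
  rw [map_sub, map_add, map_smul, h4, smul_eq_mul, mul_one] at h3
  change integralFunctional ν f ≤ integralFunctional μ f + ε
  linarith

end Measures

/-! ### The three conditions -/

section Bauer

variable {E : Type*} [AddCommGroup E] [Module ℝ E] [TopologicalSpace E] {K : Set E}

/-- The restriction map from `C(K, ℝ)` to the continuous functions on the extreme points. -/
noncomputable def restrictContinuous (K : Set E) :
    C(K, ℝ) →ₗ[ℝ] C(K.extremePoints ℝ, ℝ) where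
  toFun f := f.comp ⟨Set.inclusion extremePoints_subset, continuous_inclusion extremePoints_subset⟩
  map_add' _ _ := rfl
  map_smul' _ _ := rfl

theorem restrictContinuous_nonneg {f : C(K, ℝ)}
    (hf : ∀ x : K, (x : E) ∈ K.extremePoints ℝ → 0 ≤ f x) (x : K.extremePoints ℝ) :
    0 ≤ restrictContinuous K f x :=
  hf ⟨x, extremePoints_subset x.2⟩ x.2

variable [CompactSpace K]

theorem AffineFunctions.norm_one_le : ‖one K‖ ≤ 1 :=
  (ContinuousMap.norm_le _ zero_le_one).2 fun _ => (abs_one (α := ℝ)).le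

theorem AffineFunctions.apply_one_eq_norm (φ : StrongDual ℝ (AffineFunctions K))
    (hφ : ∀ a : AffineFunctions K, (∀ x : K, 0 ≤ a.toContinuousMap x) → 0 ≤ φ a) :
    φ (one K) = ‖φ‖ := by
  have h1 : 0 ≤ φ (one K) := hφ _ fun x => by simp
  refine le_antisymm ?_ (φ.opNorm_le_bound h1 fun a => ?_)
  · calc φ (one K) ≤ ‖φ (one K)‖ := le_abs_self _
      _ ≤ ‖φ‖ * ‖one K‖ := φ.le_opNorm _
      _ ≤ ‖φ‖ := mul_le_of_le_one_right (norm_nonneg _) norm_one_le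
  · have hb : ∀ x : K, |a.toContinuousMap x| ≤ ‖a‖ := fun x => a.toContinuousMap.norm_coe_le_norm x
    have h2 := hφ (‖a‖ • one K - a) fun x => by simpa using (abs_le.1 (hb x)).2
    have h3 := hφ (‖a‖ • one K + a) fun x => by
      have := (abs_le.1 (hb x)).1
      simp only [add_apply, AffineFunctions.smul_apply, toContinuousMap_one,
        ContinuousMap.one_apply, mul_one]
      linarith
    rw [map_sub, map_smul, smul_eq_mul] at h2
    rw [map_add, map_smul, smul_eq_mul] at h3
    rw [Real.norm_eq_abs, abs_le]
    constructor <;> linarith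

/-- If the evaluation functionals on `A(K)` extend uniquely to positive functionals `ψ x` on
`C(∂ₑK)`, then `x ↦ ψ x f` is a continuous affine function that extends `f`. -/
theorem surjective_restrictExtreme_of_existsUnique [CompactSpace (K.extremePoints ℝ)]
    (h : ∀ x : K, ∃! ψ : StrongDual ℝ C(K.extremePoints ℝ, ℝ),
      (∀ f : C(K.extremePoints ℝ, ℝ), (∀ x, 0 ≤ f x) → 0 ≤ ψ f) ∧
        ∀ a : AffineFunctions K, ψ (restrictExtreme K a) = a.toContinuousMap x) :
    Function.Surjective (restrictExtreme K) := by
  intro f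
  choose ψ hψ huniq using h
  -- `ψ x f` is the infimum of `a x` over the affine `a` above `f` on `∂ₑK`: were it smaller, the
  -- extension theorem would yield a second positive extension with a larger value at `f`.
  have hmaj : ∀ (f : C(K.extremePoints ℝ, ℝ)) (x : K) (c : ℝ), ψ x f < c →
      ∃ a : AffineFunctions K, (∀ y, f y < restrictExtreme K a y) ∧ a.toContinuousMap x < c := by
    intro f x c hc
    by_contra! hcon
    obtain ⟨ψ', h1, h2, h3⟩ := exists_positive_extension (restrictExtreme K) (one K) rfl (eval x)
      (by simp) f ((ψ x f + c) / 2) fun a ha => lt_of_lt_of_le (by linarith) (hcon a ha)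
    rw [huniq x ψ' ⟨h1, h2⟩] at h3
    linarith
  have husc : ∀ (f : C(K.extremePoints ℝ, ℝ)) (x : K) (c : ℝ), ψ x f < c →
      ∀ᶠ y in nhds x, ψ y f < c := by
    intro f x c hc
    obtain ⟨a, ha, hax⟩ := hmaj f x c hc
    filter_upwards [(isOpen_lt a.toContinuousMap.continuous continuous_const).mem_nhds hax]
      with y hy
    have := (hψ y).1 (restrictExtreme K a - f) fun z => sub_nonneg.2 (ha z).le
    rw [map_sub, (hψ y).2] at this
    exact lt_of_le_of_lt (sub_nonneg.1 this) hy
  have hcont : Continuous fun x => ψ x f := by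
    refine continuous_iff_continuousAt.2 fun x => tendsto_order.2 ⟨fun c hc => ?_, husc f x⟩
    filter_upwards [husc (-f) x (-c) (by simpa using hc)] with y hy
    simpa using hy
  have haff : IsAffineOnSet K fun x => ψ x f := by
    intro x y z s t hs ht hst hz
    have := huniq z (s • ψ x + t • ψ y) ⟨fun g hg => ?_, fun a => ?_⟩
    · simp [← this]
    · exact add_nonneg (mul_nonneg hs ((hψ x).1 g hg)) (mul_nonneg ht ((hψ y).1 g hg))
    · rw [a.isAffineOnSet x y z s t hs ht hst hz]
      simp [(hψ x).2, (hψ y).2]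
  refine ⟨⟨⟨fun x => ψ x f, hcont⟩, haff⟩, ?_⟩
  ext x
  have := huniq ⟨x, extremePoints_subset x.2⟩ (ContinuousMap.evalCLM ℝ x)
    ⟨fun g hg => hg x, fun a => rfl⟩
  change ψ ⟨x, extremePoints_subset x.2⟩ f = f x
  rw [← this]
  rfl

variable [IsTopologicalAddGroup E] [ContinuousSMul ℝ E] [LocallyConvexSpace ℝ E] [T2Space E]

theorem isometry_restrictExtreme [CompactSpace (K.extremePoints ℝ)] (hK : IsCompact K)
    (hconv : Convex ℝ K) : Isometry (restrictExtreme K) := by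
  refine AddMonoidHomClass.isometry_of_norm _ fun a => le_antisymm ?_ ?_
  · refine (ContinuousMap.norm_le _ (norm_nonneg _)).2 fun x => ?_
    exact a.toContinuousMap.norm_coe_le_norm _
  · have hle : ∀ b : AffineFunctions K, ∀ x, b.toContinuousMap x ≤ ‖restrictExtreme K b‖ :=
      fun b => b.isAffineOnSet.isConvexOnSet.le_of_forall_extremePoints_le hK hconv fun y hy =>
        (le_abs_self _).trans ((restrictExtreme K b).norm_coe_le_norm ⟨y, hy⟩)
    refine (ContinuousMap.norm_le _ (norm_nonneg _)).2 fun x => abs_le.2 ⟨?_, hle a x⟩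
    have := hle (-a) x
    rw [map_neg, norm_neg, AffineFunctions.neg_apply] at this
    exact neg_le.1 this

variable [MeasurableSpace E] [BorelSpace E]

theorem isChoquetSimplex_of_bijective_restrictExtreme (hK : IsCompact K) (hconv : Convex ℝ K)
    (hext : IsClosed (K.extremePoints ℝ)) (hR : Function.Bijective (restrictExtreme K)) :
    IsChoquetSimplex K := by
  refine ⟨hK, hconv, fun x => ?_⟩
  let e := LinearEquiv.ofBijective (restrictExtreme K) hR
  have he : ∀ (f : C(K, ℝ)) (y : K), (y : E) ∈ K.extremePoints ℝ →
      (e.symm (restrictContinuous K f)).toContinuousMap y = f y := fun f y hy =>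
    congrArg (fun g : C(K.extremePoints ℝ, ℝ) => g ⟨y, hy⟩)
      (e.apply_symm_apply (restrictContinuous K f))
  let Ψ : C(K, ℝ) →ₗ[ℝ] ℝ := eval x ∘ₗ e.symm.toLinearMap ∘ₗ restrictContinuous K
  have hΨ : ∀ f : C(K, ℝ), (∀ y : K, (y : E) ∈ K.extremePoints ℝ → 0 ≤ f y) → 0 ≤ Ψ f :=
    fun f hf => nonneg_of_forall_extremePoints hK hconv
      (fun y hy => (he f y hy).symm ▸ hf y hy) x
  have hΨa : ∀ a : AffineFunctions K, Ψ a.toContinuousMap = a.toContinuousMap x := fun a =>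
    congrArg (eval x) (e.symm_apply_apply a)
  obtain ⟨μ, hμ1, hμ2, hμ⟩ := exists_radonProbability Ψ (hΨa (one K))
    fun g hg => hΨ g fun y _ => ContinuousMap.le_def.1 hg y
  have hmax : IsMaximalProbability μ :=
    isMaximalProbability_of_nonneg_on_extremePoints hconv hext ⟨hμ1, hμ2⟩
      fun f hf => (hμ f).symm ▸ hΨ f hf
  refine ⟨μ, ⟨hmax, fun a => (hμ _).trans (hΨa a)⟩, fun ν ⟨hν, hνx⟩ => ?_⟩
  -- The affine extension of `f` from `∂ₑK` dominates a convex `f`, so `ν ≺ μ`.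
  refine (hν.2 μ hmax.1 fun f hf => ?_).symm
  have := hν.1.1
  set a := e.symm (restrictContinuous K f) with ha
  have hfa : ∀ y, f y ≤ a.toContinuousMap y := fun y => by
    have := (hf.add (-a).isAffineOnSet.isConvexOnSet).le_of_forall_extremePoints_le hK hconv
      (f := f + (-a).toContinuousMap) (c := 0) (fun z hz => by simp [ha, he f z hz]) y
    simpa using this
  calc ∫ y, f y ∂ν ≤ ∫ y, a.toContinuousMap y ∂ν :=
        integral_mono (f.integrable_of_compactSpace ν)
          (a.toContinuousMap.integrable_of_compactSpace ν) hfa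
    _ = a.toContinuousMap x := hνx a
    _ = ∫ y, f y ∂μ := (hμ f).symm

theorem existsUnique_positive_extension_of_isChoquetSimplex [CompactSpace (K.extremePoints ℝ)]
    (hS : IsChoquetSimplex K) (hext : IsClosed (K.extremePoints ℝ))
    (φ : AffineFunctions K →ₗ[ℝ] ℝ) (h1 : φ (one K) = 1)
    (hφ : ∀ a : AffineFunctions K, (∀ x : K, 0 ≤ a.toContinuousMap x) → 0 ≤ φ a) :
    ∃! ψ : StrongDual ℝ C(K.extremePoints ℝ, ℝ),
      (∀ f : C(K.extremePoints ℝ, ℝ), (∀ x, 0 ≤ f x) → 0 ≤ ψ f) ∧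
        ∀ a : AffineFunctions K, ψ (restrictExtreme K a) = φ a := by
  obtain ⟨hK, hconv, huniq⟩ := hS
  obtain ⟨ψ, hψ, hψφ, -⟩ := exists_positive_extension (restrictExtreme K) (one K) rfl φ h1 0 (-1)
    fun a ha => lt_of_lt_of_le (by norm_num) <| hφ a <|
      nonneg_of_forall_extremePoints hK hconv fun x hx => (ha ⟨x, hx⟩).le
  refine ⟨ψ, ⟨hψ, hψφ⟩, fun ψ' ⟨hψ', hψφ'⟩ => ?_⟩
  obtain ⟨x, hx⟩ := exists_eq_eval hconv φ h1 hφ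
  have hrep : ∀ χ : StrongDual ℝ C(K.extremePoints ℝ, ℝ),
      (∀ f : C(K.extremePoints ℝ, ℝ), (∀ x, 0 ≤ f x) → 0 ≤ χ f) →
      (∀ a : AffineFunctions K, χ (restrictExtreme K a) = φ a) →
      ∃ μ : Measure K, (IsMaximalProbability μ ∧ HasResultant μ x) ∧
        ∀ f : C(K, ℝ), ∫ y, f y ∂μ = χ (restrictContinuous K f) := by
    intro χ hχ hχφ
    obtain ⟨μ, hμ1, hμ2, hμ⟩ := exists_radonProbability (χ.toLinearMap ∘ₗ restrictContinuous K)
      ((hχφ (one K)).trans h1)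
      fun g hg => hχ _ (restrictContinuous_nonneg fun y _ => ContinuousMap.le_def.1 hg y)
    refine ⟨μ, ⟨isMaximalProbability_of_nonneg_on_extremePoints hconv hext ⟨hμ1, hμ2⟩
      fun f hf => ?_, fun a => ?_⟩, hμ⟩
    · rw [hμ]
      exact hχ _ (restrictContinuous_nonneg hf)
    · exact (hμ _).trans ((hχφ a).trans (hx a))
  obtain ⟨μ, hμ, hμψ⟩ := hrep ψ hψ hψφ
  obtain ⟨ν, hν, hνψ⟩ := hrep ψ' hψ' hψφ'
  ext f
  obtain ⟨F, rfl⟩ := f.exists_extension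
    ((continuous_inclusion extremePoints_subset).isClosedEmbedding
      (Set.inclusion_injective (extremePoints_subset (𝕜 := ℝ) (A := K))))
  change ψ' (restrictContinuous K F) = ψ (restrictContinuous K F)
  rw [← hμψ, ← hνψ, (huniq x).unique hμ hν]

end Bauer

theorem theorem4p6 {E : Type*} [AddCommGroup E] [Module ℝ E] [TopologicalSpace E]
    [IsTopologicalAddGroup E] [ContinuousSMul ℝ E] [LocallyConvexSpace ℝ E] [T2Space E]
    [MeasurableSpace E] [BorelSpace E]
    (K : Set E) (hK : IsCompact K) (hconv : Convex ℝ K)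
    (hext : IsClosed (K.extremePoints ℝ)) :
    haveI : CompactSpace K := isCompact_iff_compactSpace.mp hK
    haveI : CompactSpace (K.extremePoints ℝ) :=
      isCompact_iff_compactSpace.mp (hK.of_isClosed_subset hext extremePoints_subset)
    List.TFAE [
      -- every positive functional in the unit sphere of the dual of `A(K)` has exactly one
      -- positive extension along the restriction map
      ∀ φ : StrongDual ℝ (AffineFunctions K), ‖φ‖ = 1 →
        (∀ a : AffineFunctions K, (∀ x : K, 0 ≤ a.toContinuousMap x) → 0 ≤ φ a) →
        ∃! ψ : StrongDual ℝ C(K.extremePoints ℝ, ℝ),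
          (∀ f : C(K.extremePoints ℝ, ℝ), (∀ x, 0 ≤ f x) → 0 ≤ ψ f) ∧
          ∀ a : AffineFunctions K, ψ (restrictExtreme K a) = φ a,
      -- the restriction map is an isometry onto the continuous functions on the extreme boundary
      Isometry (restrictExtreme K) ∧ Function.Surjective (restrictExtreme K),
      IsBauerSimplex K] := by
  have : CompactSpace K := isCompact_iff_compactSpace.mp hK
  have : CompactSpace (K.extremePoints ℝ) :=
    isCompact_iff_compactSpace.mp (hK.of_isClosed_subset hext extremePoints_subset)
  tfae_have 1 → 2 := fun h => by
    refine ⟨isometry_restrictExtreme hK hconv,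
      surjective_restrictExtreme_of_existsUnique fun x => ?_⟩
    let φ : StrongDual ℝ (AffineFunctions K) := (eval x).mkContinuous 1 fun a => by
      rw [one_mul]
      exact a.toContinuousMap.norm_coe_le_norm x
    have hφ : ∀ a : AffineFunctions K, (∀ x : K, 0 ≤ a.toContinuousMap x) → 0 ≤ φ a :=
      fun a ha => ha x
    exact h φ (apply_one_eq_norm φ hφ).symm hφ
  tfae_have 2 → 3 := fun ⟨hiso, hsurj⟩ =>
    ⟨isChoquetSimplex_of_bijective_restrictExtreme hK hconv hext ⟨hiso.injective, hsurj⟩, hext⟩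
  tfae_have 3 → 1 := fun h φ hφ1 hφ =>
    existsUnique_positive_extension_of_isChoquetSimplex h.1 hext φ.toLinearMap
      ((apply_one_eq_norm φ hφ).trans hφ1) hφ
  tfae_finish
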